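/- Let $0<\alpha\le 2$, $\alpha\neq 1$, and let $S(\alpha,1)$ denote the symmetric $\alpha$-stable law of unit scale, i.e. the law of a real random variable $Z$ with $E\,e^{\sqrt{-1}\,tZ}=e^{-|t|^\alpha}$ for all $t\in\mathbb{R}$. Let $N,M\ge 1$, let $x=(x_1,\dots,x_N)\in\mathbb{R}^N$ be a fixed nonzero vector, let $\rho_1,\dots,\rho_M>0$ be constants, and let $s_{ij}$ ($1\le i\le N$, $1\le j\le M$) be i.i.d. random variables with law $S(\alpha,1)$. Put $$y_j=\sum_{i=1}^N x_i s_{ij},\qquad \tilde y_j=\rho_j y_j,\qquad j=1,\dots,M,$$ and, for a coordinate $i$, let the absolute minimum estimator be $$\hat x_{i,\min}=\frac{\tilde y_t}{s_{it}},\qquad t\in\operatorname*{argmin}_{1\le j\le M}\left|\frac{\tilde y_j}{s_{ij}}\right| ,$$ with ties broken arbitrarily. Let $\epsilon>0$, $\theta=\bigl(\sum_{i=1}^N|x_i|^\alpha\bigr)^{1/\alpha}$ and $\psi=(\epsilon/\theta)^{\alpha/(1-\alpha)}$. If $$\frac{\psi}{\rho_j^{\alpha/(1-\alpha)}}<\frac13\qquad\text{for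 every } j=1,\dots,M,$$ then, for every $i\in\{1,\dots,N\}$, $$\mathbf{Pr}\left(|\hat x_{i,\min}|>\epsilon,\ x_i=0\right)\le\prod_{j=1}^M\frac{1}{1+\psi/\rho_j^{\alpha/(1-\alpha)}} .$$ -/

import Mathlib

open MeasureTheory ProbabilityTheory

namespace StableRecovery

/-- `X` has the symmetric `α`-stable law `S(α,1)` of unit scale under `P`:
`E exp(√-1 t X) = exp(-|t|^α)` for all real `t`. -/
def IsUnitStable {Ω : Type*} [MeasurableSpace Ω] (P : Measure Ω) (α : ℝ) (X : Ω → ℝ) : Prop :=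
  AEMeasurable X P ∧ ∀ t : ℝ, charFun (P.map X) t = Complex.exp (-((|t| ^ α : ℝ) : ℂ))

/-- The random `N × M` design matrix `S` has i.i.d. entries with law `S(α,1)`. -/
structure IsStableDesign {Ω : Type*} [MeasurableSpace Ω] (P : Measure Ω) (α : ℝ) {N M : ℕ}
    (S : Ω → Fin N → Fin M → ℝ) : Prop where
  stable : ∀ i j, IsUnitStable P α (fun ω => S ω i j)
  indep : iIndepFun (fun (p : Fin N × Fin M) (ω : Ω) => S ω p.1 p.2) P

/-- The linear measurements `y_j = ∑_i x_i s_{ij}`. -/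
def measurement {N M : ℕ} (x : Fin N → ℝ) (s : Fin N → Fin M → ℝ) (j : Fin M) : ℝ :=
  ∑ i, x i * s i j

/-- The measurements with multiplicative noise, `ρ_j y_j`. -/
def noisyMeasurement {N M : ℕ} (ρ : Fin M → ℝ) (x : Fin N → ℝ) (s : Fin N → Fin M → ℝ)
    (j : Fin M) : ℝ :=
  ρ j * measurement x s j

/-- The ratio statistics of coordinate `i`, formed from the noisy measurements. -/
noncomputable def noisyRatio {N M : ℕ} (ρ : Fin M → ℝ) (x : Fin N → ℝ) (s : Fin N → Fin M → ℝ)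
    (i : Fin N) (j : Fin M) : ℝ :=
  noisyMeasurement ρ x s j / s i j

/-- `t` is an index at which `j ↦ |z_j|` is smallest. The absolute minimum estimator is then
`z_t`. -/
def IsAbsArgmin {M : ℕ} (z : Fin M → ℝ) (t : Fin M) : Prop :=
  ∀ j, |z t| ≤ |z j|

/-- `θ = (∑_i |x_i|^α)^{1/α}`. -/
noncomputable def theta {N : ℕ} (α : ℝ) (x : Fin N → ℝ) : ℝ :=
  (∑ i, |x i| ^ α) ^ (1 / α)

/-- `ψ = (ε/θ)^{α/(1-α)}`. -/
noncomputable def psi {N : ℕ} (α ε : ℝ) (x : Fin N → ℝ) : ℝ :=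
  (ε / theta α x) ^ (α / (1 - α))

end StableRecovery

/-! If `x i = 0`, the minimum exceeds `ε` only if every column satisfies `ε|s_ij| < |ρ_j y_j|`. The
columns are independent, and `y_j` is independent of `s_ij` and distributed as `θZ`, so everything
reduces to bounding `dominance μ u v`, the probability of `u|Z₂| < v|Z₁|`, at `u = ε`, `v = ρ_j θ`.

No density is used. `dominance_le` gives `v^α / (u^α + v^α)` for `u ≤ v`, from stability and a
Boolean-cube inequality. Take `K` i.i.d. stable values with random signs, and a random subset of
density `p ≤ 1/2`. Let `B` be the signed sum over the subset and `A` the sum over its complement.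
Flipping the signs in the subset turns `A + B` into `A - B`, and the two agree in sign when `|B| <
|A|`. The sign of the sum is an odd function of the signs, so `noise_stability_le` bounds its
correlation by `1 - 2p`, and `|B| < |A|` has probability at most `1 - p`. By stability this event
depends only on the subset's proportion, which concentrates at `p` as `K → ∞`. Comparing exponents
then gives the stated form. -/

namespace StableRecovery

/-! ### Noise stability on the Boolean cube -/

/-- The probability that independent Bernoulli(`p`) bits take the values `b`. -/
def bernoulliWeight (p : ℝ) {K : ℕ} (b : Fin K → Bool) : ℝ :=
  ∏ i, if b i then p else 1 - p

theorem sum_fin_succ_bool {K : ℕ} (F : (Fin (K + 1) → Bool) → ℝ) :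
    ∑ e, F e = ∑ e : Fin K → Bool, (F (Fin.cons true e) + F (Fin.cons false e)) := by
  rw [← (Fin.consEquiv (fun _ : Fin (K + 1) => Bool)).sum_comp, Fintype.sum_prod_type,
    Fintype.sum_bool, ← Finset.sum_add_distrib]
  rfl

theorem bernoulliWeight_cons (p : ℝ) {K : ℕ} (c : Bool) (b : Fin K → Bool) :
    bernoulliWeight p (Fin.cons c b : Fin (K + 1) → Bool) =
      (if c then p else 1 - p) * bernoulliWeight p b := by
  simp [bernoulliWeight, Fin.prod_univ_succ]

theorem bernoulliWeight_nonneg {p : ℝ} (hp0 : 0 ≤ p) (hp1 : p ≤ 1) {K : ℕ} (b : Fin K → Bool) :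
    0 ≤ bernoulliWeight p b :=
  Finset.prod_nonneg fun i _ => by split_ifs <;> linarith

theorem bernoulliWeight_eq_pow (p : ℝ) {K : ℕ} (b : Fin K → Bool) :
    bernoulliWeight p b = p ^ (Finset.univ.filter fun i => b i = true).card *
      (1 - p) ^ (K - (Finset.univ.filter fun i => b i = true).card) := by
  have h := Finset.card_filter_add_card_filter_not (s := (Finset.univ : Finset (Fin K)))
    (fun i => b i = true)
  rw [Finset.card_univ, Fintype.card_fin] at h
  rw [bernoulliWeight, Finset.prod_ite, Finset.prod_const, Finset.prod_const]
  congr 2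
  omega

/-- The number of successes among `K` Bernoulli(`p`) bits is binomial. -/
theorem sum_bernoulliWeight_mul_card (p : ℝ) (K : ℕ) (F : ℕ → ℝ) :
    ∑ b : Fin K → Bool, bernoulliWeight p b * F (Finset.univ.filter fun i => b i = true).card =
      ∑ k ∈ Finset.range (K + 1), (K.choose k : ℝ) * p ^ k * (1 - p) ^ (K - k) * F k := by
  have h := Finset.sum_powerset_apply_card (fun k => p ^ k * (1 - p) ^ (K - k) * F k)
    (x := (Finset.univ : Finset (Fin K)))
  rw [Finset.card_univ, Fintype.card_fin] at h
  simp only [nsmul_eq_mul, ← mul_assoc] at h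
  rw [← h]
  refine Finset.sum_bij' (fun b _ => Finset.univ.filter fun i => b i = true)
    (fun s _ i => decide (i ∈ s)) ?_ ?_ ?_ ?_ ?_
  · simp
  · simp
  · intro b _; ext i; simp
  · intro s _; ext i; simp
  · intro b _; rw [bernoulliWeight_eq_pow]

theorem sum_bernoulliWeight (p : ℝ) (K : ℕ) :
    ∑ b : Fin K → Bool, bernoulliWeight p b = 1 := by
  have h := sum_bernoulliWeight_mul_card p K (fun _ => 1)
  simp only [mul_one] at h
  rw [h]
  have h2 := add_pow p (1 - p) K
  rw [add_sub_cancel, one_pow] at h2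
  exact (Finset.sum_congr rfl fun k _ => by ring).trans h2.symm

/-- Coordinatewise exclusive or: flips the bits of `e` selected by `b`. -/
def flip {K : ℕ} (e b : Fin K → Bool) : Fin K → Bool := fun i => xor (e i) (b i)

theorem flip_cons {K : ℕ} (c d : Bool) (e b : Fin K → Bool) :
    flip (Fin.cons c e : Fin (K + 1) → Bool) (Fin.cons d b) = Fin.cons (xor c d) (flip e b) := by
  funext i
  refine Fin.cases ?_ (fun j => ?_) i <;> simp [flip]

/-- Noise stability on the discrete cube: flipping each bit independently with probability
`p ≤ 1/2` contracts the mean-zero part by `1 - 2p`. -/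
theorem noise_stability_le {p : ℝ} (hp0 : 0 ≤ p) (hp : p ≤ 1 / 2) (K : ℕ)
    (g : (Fin K → Bool) → ℝ) :
    ∑ b, bernoulliWeight p b * ∑ e, g e * g (flip e b) ≤
      (1 - 2 * p) * ∑ e, g e ^ 2 + 2 * p / 2 ^ K * (∑ e, g e) ^ 2 := by
  induction K with
  | zero =>
    simp only [Fintype.sum_unique, bernoulliWeight, Finset.univ_eq_empty, Finset.prod_empty]
    obtain ⟨c, hc⟩ : ∃ c, ∀ e, g e = c :=
      ⟨g default, fun e => congrArg g (Subsingleton.elim _ _)⟩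
    simp only [hc]
    apply le_of_eq
    ring
  | succ K ih =>
    set u : (Fin K → Bool) → ℝ := fun e => g (Fin.cons true e) with hu
    set v : (Fin K → Bool) → ℝ := fun e => g (Fin.cons false e) with hv
    -- Split `g` into its even and odd parts in the first bit. Noise in that bit multiplies the odd
    -- part by `1 - 2p`, so for it mere contraction suffices; Cauchy–Schwarz absorbs its mean term.
    have i0 := ih (fun e => u e + v e)
    have i1 := ih (fun e => u e - v e)
    have cs : (∑ e, (u e - v e)) ^ 2 ≤ 2 ^ K * ∑ e, (u e - v e) ^ 2 := by
      have := sq_sum_le_card_mul_sum_sq (s := (Finset.univ : Finset (Fin K → Bool)))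
        (f := fun e => u e - v e)
      simpa using this
    have hl : ∑ b, bernoulliWeight p b * ∑ e, g e * g (flip e b) =
        1 / 2 * ∑ b, bernoulliWeight p b *
            ∑ e, (u e + v e) * (u (flip e b) + v (flip e b)) +
        (1 - 2 * p) / 2 * ∑ b, bernoulliWeight p b *
            ∑ e, (u e - v e) * (u (flip e b) - v (flip e b)) := by
      rw [sum_fin_succ_bool, Finset.mul_sum, Finset.mul_sum, ← Finset.sum_add_distrib]
      refine Finset.sum_congr rfl fun b _ => ?_
      simp only [sum_fin_succ_bool, bernoulliWeight_cons, flip_cons, Finset.mul_sum,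
        ← Finset.sum_add_distrib]
      refine Finset.sum_congr rfl fun e _ => ?_
      simp only [hu, hv, Bool.xor_false, Bool.xor_true, Bool.not_true, Bool.not_false, if_true,
        Bool.false_eq_true, if_false]
      ring
    have hs : ∑ e, g e ^ 2 = 1 / 2 * ∑ e, (u e + v e) ^ 2 + 1 / 2 * ∑ e, (u e - v e) ^ 2 := by
      rw [sum_fin_succ_bool, Finset.mul_sum, Finset.mul_sum, ← Finset.sum_add_distrib]
      exact Finset.sum_congr rfl fun e _ => by simp only [hu, hv]; ring
    have hm : ∑ e, g e = ∑ e, (u e + v e) := sum_fin_succ_bool g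
    have cs' : 2 * p / 2 ^ K * (∑ e, (u e - v e)) ^ 2 ≤ 2 * p * ∑ e, (u e - v e) ^ 2 := by
      have h2 : (0 : ℝ) < 2 ^ K := by positivity
      calc 2 * p / 2 ^ K * (∑ e, (u e - v e)) ^ 2
          ≤ 2 * p / 2 ^ K * (2 ^ K * ∑ e, (u e - v e) ^ 2) := by gcongr
        _ = _ := by field_simp
    have i1' : ∑ b, bernoulliWeight p b * ∑ e, (u e - v e) * (u (flip e b) - v (flip e b)) ≤
        ∑ e, (u e - v e) ^ 2 := by linarith
    have i1'' := mul_le_mul_of_nonneg_left i1' (show 0 ≤ (1 - 2 * p) / 2 by linarith)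
    rw [hl, hs, hm, pow_succ]
    have h3 : 2 * p / (2 ^ K * 2) * (∑ e, (u e + v e)) ^ 2 =
        1 / 2 * (2 * p / 2 ^ K * (∑ e, (u e + v e)) ^ 2) := by ring
    rw [h3]
    linarith

/-! ### Linear forms in i.i.d. stable variables -/

/-- `μ` is the symmetric `α`-stable law of unit scale. -/
def IsUnitStableLaw (α : ℝ) (μ : Measure ℝ) : Prop :=
  ∀ t : ℝ, charFun μ t = Complex.exp (-((|t| ^ α : ℝ) : ℂ))

theorem measurable_linearForm {ι : Type*} [Fintype ι] (c : ι → ℝ) :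
    Measurable fun v : ι → ℝ => ∑ i, c i * v i := by fun_prop

section LinearForms

variable {ι : Type*} [Fintype ι] {α : ℝ} {μ : Measure ℝ} [IsProbabilityMeasure μ]

theorem charFun_map_linearForm (hμ : IsUnitStableLaw α μ) (c : ι → ℝ) (t : ℝ) :
    charFun ((Measure.pi fun _ : ι => μ).map fun v => ∑ i, c i * v i) t =
      Complex.exp (-((∑ i, |c i * t| ^ α : ℝ) : ℂ)) := by
  have hind : iIndepFun (fun (i : ι) (v : ι → ℝ) => c i * v i) (Measure.pi fun _ : ι => μ) :=
    iIndepFun_pi (X := fun i x => c i * x) (fun i => by fun_prop)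
  rw [hind.charFun_map_fun_sum_eq_prod (fun i => ((measurable_pi_apply i).const_mul _).aemeasurable),
    Finset.prod_apply]
  have : ∀ i, charFun ((Measure.pi fun _ : ι => μ).map fun v => c i * v i) t =
      Complex.exp (-((|c i * t| ^ α : ℝ) : ℂ)) := fun i => by
    rw [charFun_map_mul_comp (measurable_pi_apply i).aemeasurable,
      (measurePreserving_eval (fun _ : ι => μ) i).map_eq, hμ]
  simp only [this]
  rw [← Complex.exp_sum]
  push_cast
  rw [Finset.sum_neg_distrib]

theorem map_linearForm (hα : 0 < α) (hμ : IsUnitStableLaw α μ) (c : ι → ℝ) :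
    (Measure.pi fun _ : ι => μ).map (fun v => ∑ i, c i * v i) =
      μ.map ((∑ i, |c i| ^ α) ^ (1 / α) * ·) := by
  have hm : Measurable fun v : ι → ℝ => ∑ i, c i * v i := by fun_prop
  have := Measure.isProbabilityMeasure_map (μ := Measure.pi fun _ : ι => μ) hm.aemeasurable
  have := Measure.isProbabilityMeasure_map (μ := μ)
    (f := ((∑ i, |c i| ^ α) ^ (1 / α) * ·)) (by fun_prop)
  refine Measure.ext_of_charFun (funext fun t => ?_)
  have h0 : 0 ≤ ∑ i, |c i| ^ α := Finset.sum_nonneg fun i _ => by positivity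
  rw [charFun_map_linearForm hμ, charFun_map_mul, hμ, abs_mul, abs_of_nonneg (by positivity),
    Real.mul_rpow (by positivity) (abs_nonneg t), ← Real.rpow_mul h0, one_div,
    inv_mul_cancel₀ hα.ne', Real.rpow_one, Finset.sum_mul]
  simp only [abs_mul, Real.mul_rpow (abs_nonneg _) (abs_nonneg t)]

/-- With disjoint supports, `|a_i t₁ + b_i t₂|^α` splits as `|a_i t₁|^α + |b_i t₂|^α`, so the joint
characteristic function factors. -/
theorem indepFun_linearForm (hα : 0 < α) (hμ : IsUnitStableLaw α μ) (a b : ι → ℝ)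
    (hab : ∀ i, a i = 0 ∨ b i = 0) :
    IndepFun (fun v : ι → ℝ => ∑ i, a i * v i) (fun v => ∑ i, b i * v i)
      (Measure.pi fun _ : ι => μ) := by
  rw [indepFun_iff_charFun_prod (measurable_linearForm a).aemeasurable
    (measurable_linearForm b).aemeasurable]
  intro t
  rw [charFun_map_linearForm hμ, charFun_map_linearForm hμ, ← Complex.exp_add]
  have h1 := charFun_map_linearForm hμ (fun i => a i * t.ofLp.1 + b i * t.ofLp.2) 1
  rw [charFun_apply, integral_map (measurable_linearForm _).aemeasurable (by fun_prop)] at h1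
  have hm : Measurable fun v : ι → ℝ => WithLp.toLp 2 (∑ i, a i * v i, ∑ i, b i * v i) := by
    fun_prop
  rw [charFun_apply, integral_map hm.aemeasurable (by fun_prop)]
  refine Eq.trans ?_ (h1.trans ?_)
  · refine integral_congr_ae (Filter.Eventually.of_forall fun v => ?_)
    simp only [WithLp.prod_inner_apply, RCLike.inner_apply, conj_trivial, Finset.mul_sum, one_mul,
      add_mul, Finset.sum_add_distrib]
    congr 5 <;> funext i <;> ring
  · rw [← neg_add, ← Complex.ofReal_add, ← Finset.sum_add_distrib]
    congr 3
    refine Finset.sum_congr rfl fun i _ => ?_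
    rcases hab i with h | h <;> simp [h, Real.zero_rpow hα.ne']

/-- The probability that `u |Z₂| < v |Z₁|` for independent `Z₁, Z₂` with law `μ`. -/
noncomputable def dominance (μ : Measure ℝ) (u v : ℝ) : ℝ :=
  (μ.prod μ).real {z | u * |z.2| < v * |z.1|}

theorem measureReal_linearForm_lt (hα : 0 < α) (hμ : IsUnitStableLaw α μ) (a b : ι → ℝ)
    (hab : ∀ i, a i = 0 ∨ b i = 0) :
    (Measure.pi fun _ : ι => μ).real {v | |∑ i, b i * v i| < |∑ i, a i * v i|} =
      dominance μ ((∑ i, |b i| ^ α) ^ (1 / α)) ((∑ i, |a i| ^ α) ^ (1 / α)) := by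
  have h := (indepFun_iff_map_prod_eq_prod_map_map (measurable_linearForm a).aemeasurable
    (measurable_linearForm b).aemeasurable).1
    (indepFun_linearForm hα hμ a b hab)
  rw [map_linearForm hα hμ, map_linearForm hα hμ, Measure.map_prod_map _ _ (by fun_prop)
    (by fun_prop)] at h
  have hs : MeasurableSet {z : ℝ × ℝ | |z.2| < |z.1|} :=
    measurableSet_lt (by fun_prop) (by fun_prop)
  have h2 := congrArg (fun ν : Measure (ℝ × ℝ) => ν.real {z : ℝ × ℝ | |z.2| < |z.1|}) h
  rw [map_measureReal_apply (by fun_prop) hs, map_measureReal_apply (by fun_prop) hs] at h2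
  rw [dominance]
  refine h2.trans ?_
  congr 1
  ext z
  have hA : 0 ≤ (∑ i, |a i| ^ α) ^ (1 / α) :=
    Real.rpow_nonneg (Finset.sum_nonneg fun i _ => by positivity) _
  have hB : 0 ≤ (∑ i, |b i| ^ α) ^ (1 / α) :=
    Real.rpow_nonneg (Finset.sum_nonneg fun i _ => by positivity) _
  simp only [Set.mem_preimage, Set.mem_ofPred_eq, Prod.map_fst, Prod.map_snd, abs_mul,
    abs_of_nonneg hA, abs_of_nonneg hB]

end LinearForms

theorem dominance_nonneg (μ : Measure ℝ) (u v : ℝ) : 0 ≤ dominance μ u v := measureReal_nonneg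

theorem dominance_mul_left (μ : Measure ℝ) {c : ℝ} (hc : 0 < c) (u v : ℝ) :
    dominance μ (c * u) (c * v) = dominance μ u v := by
  simp only [dominance, mul_assoc, mul_lt_mul_iff_right₀ hc]

theorem dominance_mono (μ : Measure ℝ) [IsProbabilityMeasure μ] {u v u' v' : ℝ} (hu : u' ≤ u)
    (hv : v ≤ v') : dominance μ u v ≤ dominance μ u' v' := by
  refine measureReal_mono fun z (hz : u * |z.2| < v * |z.1|) => ?_
  calc u' * |z.2| ≤ u * |z.2| := by gcongr
    _ < v * |z.1| := hz
    _ ≤ v' * |z.1| := by gcongr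

/-! ### The random sign and subset argument -/

/-- For fixed values `v`, random signs `e` and a random subset `b`, the complementary part of the
signed sum exceeds the part selected by `b` with probability at most `1 - p`. -/
theorem bernoulli_average_indicator_le {p : ℝ} (hp0 : 0 ≤ p) (hp : p ≤ 1 / 2) {K : ℕ}
    (v : Fin K → ℝ) :
    ∑ b : Fin K → Bool, bernoulliWeight p b * ∑ e : Fin K → Bool,
      (if |∑ i, (if b i then (if e i then 1 else -1) else 0) * v i| <
        |∑ i, (if b i then 0 else (if e i then 1 else -1)) * v i| then (1 : ℝ) else 0) ≤
      (1 - p) * 2 ^ K := by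
  set g : (Fin K → Bool) → ℝ := fun e => Real.sign (∑ i, (if e i then 1 else -1) * v i) with hg
  have hns := noise_stability_le hp0 hp K g
  have hodd : ∑ e, g e = 0 := by
    have h : ∑ e, g e = ∑ e, -g e := by
      refine Fintype.sum_equiv (Equiv.piCongrRight fun _ => Equiv.boolNot) _ _ fun e => ?_
      simp only [hg]
      rw [← Real.sign_neg, ← Finset.sum_neg_distrib]
      congr 1
      refine Finset.sum_congr rfl fun i _ => ?_
      cases h : e i <;> simp [h]
    rw [Finset.sum_neg_distrib] at h
    linarith
  have hsq : ∑ e, g e ^ 2 ≤ 2 ^ K := by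
    calc ∑ e, g e ^ 2 ≤ ∑ _e : Fin K → Bool, (1 : ℝ) := by
          refine Finset.sum_le_sum fun e _ => ?_
          simp only [hg]
          rcases Real.sign_apply_eq (∑ i, (if e i then 1 else -1) * v i) with h | h | h <;>
            rw [h] <;> norm_num
      _ = 2 ^ K := by simp
  -- If `|B| < |A|`, then `A + B` and `A - B` share the nonzero sign of `A` and the product is `1`;
  -- otherwise the left side is `-1`.
  have hpt : ∀ b e : Fin K → Bool, 2 * (if |∑ i, (if b i then (if e i then 1 else -1) else 0) * v i|
        < |∑ i, (if b i then 0 else (if e i then 1 else -1)) * v i| then (1 : ℝ) else 0) - 1 ≤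
      g e * g (flip e b) := by
    intro b e
    set B := ∑ i, (if b i then (if e i then 1 else -1) else 0) * v i with hB
    set A := ∑ i, (if b i then 0 else (if e i then 1 else -1)) * v i with hA
    have h1 : ∑ i, (if e i then 1 else -1) * v i = A + B := by
      rw [hA, hB, ← Finset.sum_add_distrib]
      refine Finset.sum_congr rfl fun i _ => ?_
      cases b i <;> simp
    have h2 : ∑ i, (if flip e b i then 1 else -1) * v i = A - B := by
      rw [hA, hB, ← Finset.sum_sub_distrib]
      refine Finset.sum_congr rfl fun i _ => ?_
      cases hb : b i <;> cases he : e i <;> simp [flip, hb, he]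
    simp only [hg, h1, h2]
    split_ifs with h
    · rw [abs_lt] at h
      rcases le_total 0 A with h0 | h0
      · rw [abs_of_nonneg h0] at h
        rw [Real.sign_of_pos (by linarith), Real.sign_of_pos (by linarith)]
        norm_num
      · rw [abs_of_nonpos h0] at h
        rw [Real.sign_of_neg (by linarith), Real.sign_of_neg (by linarith)]
        norm_num
    · rcases Real.sign_apply_eq (A + B) with h | h | h <;>
        rcases Real.sign_apply_eq (A - B) with h' | h' | h' <;> simp [h, h']
  have hsum : ∑ b : Fin K → Bool, bernoulliWeight p b * ∑ e : Fin K → Bool,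
      (2 * (if |∑ i, (if b i then (if e i then 1 else -1) else 0) * v i|
        < |∑ i, (if b i then 0 else (if e i then 1 else -1)) * v i| then (1 : ℝ) else 0) - 1) ≤
      ∑ b, bernoulliWeight p b * ∑ e, g e * g (flip e b) :=
    Finset.sum_le_sum fun b _ => mul_le_mul_of_nonneg_left
      (Finset.sum_le_sum fun e _ => hpt b e) (bernoulliWeight_nonneg hp0 (by linarith) b)
  simp only [Finset.sum_sub_distrib, ← Finset.mul_sum, mul_sub, Finset.sum_const,
    Finset.card_univ, Fintype.card_fun, Fintype.card_bool, Fintype.card_fin, nsmul_eq_mul,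
    mul_one, ← Finset.sum_mul, sum_bernoulliWeight, one_mul, mul_left_comm _ (2 : ℝ)] at hsum
  rw [hodd] at hns
  push_cast at hsum
  have := mul_le_mul_of_nonneg_left hsq (show 0 ≤ 1 - 2 * p by linarith)
  nlinarith

/-- `dominance` for weights `q` and `1 - q` on the `α`-power scale. -/
noncomputable def splitDominance (α : ℝ) (μ : Measure ℝ) (q : ℝ) : ℝ :=
  dominance μ (q ^ (1 / α)) ((1 - q) ^ (1 / α))

theorem splitDominance_antitone {α : ℝ} (hα : 0 < α) (μ : Measure ℝ) [IsProbabilityMeasure μ]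
    {q r : ℝ} (hq : 0 ≤ q) (hr : r ≤ 1) (hqr : q ≤ r) :
    splitDominance α μ r ≤ splitDominance α μ q :=
  dominance_mono μ (Real.rpow_le_rpow hq hqr (by positivity))
    (Real.rpow_le_rpow (by linarith) (by linarith) (by positivity))

/-- Signs do not affect the scale of a stable sum, so only the subset's size matters; the common
factor `K^(1/α)` cancels. -/
theorem measureReal_signed_sum_lt {α : ℝ} (hα : 0 < α) {μ : Measure ℝ} [IsProbabilityMeasure μ]
    (hμ : IsUnitStableLaw α μ) {K : ℕ} (hK : K ≠ 0) (b e : Fin K → Bool) :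
    (Measure.pi fun _ : Fin K => μ).real
      {v | |∑ i, (if b i then (if e i then 1 else -1) else 0) * v i| <
        |∑ i, (if b i then 0 else (if e i then 1 else -1)) * v i|} =
      splitDominance α μ ((Finset.univ.filter fun i => b i = true).card / K) := by
  have hK' : (0 : ℝ) < K := by exact_mod_cast Nat.pos_of_ne_zero hK
  have hcard := Finset.card_filter_add_card_filter_not (s := (Finset.univ : Finset (Fin K)))
    (fun i => b i = true)
  rw [Finset.card_univ, Fintype.card_fin] at hcard
  have hcard' : ((Finset.univ.filter fun i => ¬ b i = true).card : ℝ) =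
      K - (Finset.univ.filter fun i => b i = true).card := by
    rw [eq_sub_iff_add_eq']; exact_mod_cast hcard
  rw [measureReal_linearForm_lt hα hμ _ _ (fun i => by cases b i <;> simp)]
  have hB : ∑ i, |(if b i then (if e i then (1 : ℝ) else -1) else 0)| ^ α =
      (Finset.univ.filter fun i => b i = true).card := by
    rw [Finset.card_filter]
    push_cast
    refine Finset.sum_congr rfl fun i _ => ?_
    cases b i <;> cases e i <;> simp [Real.zero_rpow hα.ne']
  have hA : ∑ i, |(if b i then 0 else (if e i then (1 : ℝ) else -1))| ^ α =
      (Finset.univ.filter fun i => ¬ b i = true).card := by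
    rw [Finset.card_filter]
    push_cast
    refine Finset.sum_congr rfl fun i _ => ?_
    cases b i <;> cases e i <;> simp [Real.zero_rpow hα.ne']
  rw [hB, hA, hcard', splitDominance]
  have hk : ((Finset.univ.filter fun i => b i = true).card : ℝ) ≤ K := by
    exact_mod_cast (by omega : (Finset.univ.filter fun i => b i = true).card ≤ K)
  have h1 : (1 : ℝ) - (Finset.univ.filter fun i => b i = true).card / K =
    (K - (Finset.univ.filter fun i => b i = true).card) / K := by field_simp
  rw [h1, Real.div_rpow (by positivity) hK'.le, Real.div_rpow (by linarith) hK'.le,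
    div_eq_inv_mul (_ ^ (1 / α)), div_eq_inv_mul (_ ^ (1 / α)),
    dominance_mul_left μ (by positivity)]

/-- Integrates the pointwise bound over the stable values. Every sign pattern contributes equally,
which cancels `2 ^ K`. -/
theorem binomial_average_splitDominance_le {α : ℝ} (hα : 0 < α) {μ : Measure ℝ}
    [IsProbabilityMeasure μ] (hμ : IsUnitStableLaw α μ) {p : ℝ} (hp0 : 0 ≤ p) (hp : p ≤ 1 / 2)
    {K : ℕ} (hK : K ≠ 0) :
    ∑ k ∈ Finset.range (K + 1), (K.choose k : ℝ) * p ^ k * (1 - p) ^ (K - k) *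
      splitDominance α μ (k / K) ≤ 1 - p := by
  rw [← sum_bernoulliWeight_mul_card p K fun k => splitDominance α μ (k / K)]
  have hms : ∀ b e : Fin K → Bool, MeasurableSet
      {v : Fin K → ℝ | |∑ i, (if b i then (if e i then 1 else -1) else 0) * v i| <
        |∑ i, (if b i then 0 else (if e i then 1 else -1)) * v i|} := fun b e =>
    measurableSet_lt (measurable_linearForm _).abs (measurable_linearForm _).abs
  have hind : ∀ b e : Fin K → Bool, (fun v : Fin K → ℝ =>
      if |∑ i, (if b i then (if e i then 1 else -1) else 0) * v i| <
        |∑ i, (if b i then 0 else (if e i then 1 else -1)) * v i| then (1 : ℝ) else 0) =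
      Set.indicator {v : Fin K → ℝ |
        |∑ i, (if b i then (if e i then 1 else -1) else 0) * v i| <
        |∑ i, (if b i then 0 else (if e i then 1 else -1)) * v i|} 1 := fun b e => by
    funext v; simp [Set.indicator_apply]
  have hint : ∀ b e : Fin K → Bool, Integrable (fun v : Fin K → ℝ =>
      if |∑ i, (if b i then (if e i then 1 else -1) else 0) * v i| <
        |∑ i, (if b i then 0 else (if e i then 1 else -1)) * v i| then (1 : ℝ) else 0)
      (Measure.pi fun _ : Fin K => μ) := fun b e => by
    rw [hind]
    exact (integrable_const (1 : ℝ)).indicator (hms b e)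
  have h := integral_mono (μ := Measure.pi fun _ : Fin K => μ)
    (integrable_finsetSum _ fun b _ => (integrable_finsetSum _ fun e _ => hint b e).const_mul _)
    (integrable_const _) (fun v => bernoulli_average_indicator_le hp0 hp v)
  rw [integral_finsetSum _ fun b _ =>
    (integrable_finsetSum _ fun e _ => hint b e).const_mul _] at h
  simp only [integral_const_mul, integral_finsetSum _ fun e _ => hint _ e, hind,
    integral_indicator_one (hms _ _), measureReal_signed_sum_lt hα hμ hK, integral_const,
    probReal_univ, one_smul, Finset.sum_const, Finset.card_univ, Fintype.card_fun,
    Fintype.card_bool, Fintype.card_fin, nsmul_eq_mul, mul_left_comm _ ((2 ^ K : ℕ) : ℝ),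
    ← Finset.mul_sum] at h
  push_cast at h
  rw [mul_comm] at h
  exact le_of_mul_le_mul_right h (by positivity)

/-! ### Passage to the limit and the tail bound -/

theorem splitDominance_le {α : ℝ} (hα : 0 < α) {μ : Measure ℝ} [IsProbabilityMeasure μ]
    (hμ : IsUnitStableLaw α μ) {p : ℝ} (hp0 : 0 < p) (hp : p ≤ 1 / 2) :
    splitDominance α μ p ≤ 1 - p := by
  have key : ∀ q, 0 < q → q < p → splitDominance α μ p ≤ 1 - q := by
    intro q hq0 hqp
    -- A continuous minorant of `splitDominance` with value `splitDominance α μ p` at `q`: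
    -- monotonicity gives the bound below `p`, and above `p` it is nonpositive. Its Bernstein
    -- polynomials at `q` are binomial averages, so no continuity of `splitDominance` is needed.
    let G : C(unitInterval, ℝ) :=
      ⟨fun r => splitDominance α μ p - max 0 (((r : ℝ) - q) / (p - q)), by fun_prop⟩
    have hG : ∀ r : unitInterval, G r = splitDominance α μ p - max 0 (((r : ℝ) - q) / (p - q)) :=
      fun _ => rfl
    have hpq : 0 < p - q := by linarith
    have hle : ∀ r : unitInterval, G r ≤ splitDominance α μ r := by
      intro r
      rw [hG]
      rcases le_total (r : ℝ) p with h | h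
      · have := splitDominance_antitone hα μ r.2.1 (by linarith) h
        linarith [le_max_left 0 (((r : ℝ) - q) / (p - q))]
      · have h1 : 1 ≤ ((r : ℝ) - q) / (p - q) := by rw [le_div_iff₀ hpq]; linarith
        have h2 : splitDominance α μ p ≤ 1 := measureReal_le_one
        have h3 : 0 ≤ splitDominance α μ r := dominance_nonneg _ _ _
        linarith [le_max_right 0 (((r : ℝ) - q) / (p - q))]
    let q' : unitInterval := ⟨q, hq0.le, by linarith⟩
    have hlim := ((continuous_eval_const q').tendsto G).comp (bernsteinApproximation_uniform G)
    have hGq : G q' = splitDominance α μ p := by simp [hG, q']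
    rw [← hGq]
    refine le_of_tendsto hlim (Filter.eventually_atTop.2 ⟨1, fun K hK => ?_⟩)
    refine le_trans ?_ (binomial_average_splitDominance_le hα hμ hq0.le (by linarith)
      (Nat.one_le_iff_ne_zero.1 hK))
    rw [Function.comp_apply, bernsteinApproximation.apply, Finset.sum_range]
    refine Finset.sum_le_sum fun k _ => ?_
    rw [smul_eq_mul, ← bernstein_apply K k q']
    exact mul_le_mul_of_nonneg_left (hle _) bernstein_nonneg
  by_contra! h
  -- The midpoint of `1 - splitDominance α μ p` and `p` contradicts `key`; `p / 2` keeps the witness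
  -- positive.
  have h1 := key (max (p / 2) ((1 - splitDominance α μ p + p) / 2))
    (lt_max_of_lt_left (by linarith)) (max_lt (by linarith) (by linarith))
  linarith [le_max_right (p / 2) ((1 - splitDominance α μ p + p) / 2)]

/-- For independent `Z₁, Z₂` with the unit `α`-stable law and `0 < u ≤ v`, the probability of
`u |Z₂| < v |Z₁|` is at most `v ^ α / (u ^ α + v ^ α)`. -/
theorem dominance_le {α : ℝ} (hα : 0 < α) {μ : Measure ℝ} [IsProbabilityMeasure μ]
    (hμ : IsUnitStableLaw α μ) {u v : ℝ} (hu : 0 < u) (huv : u ≤ v) :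
    dominance μ u v ≤ v ^ α / (u ^ α + v ^ α) := by
  have hv : 0 < v := hu.trans_le huv
  have hu' : 0 < u ^ α := by positivity
  have hv' : 0 < v ^ α := by positivity
  have huv' : u ^ α ≤ v ^ α := Real.rpow_le_rpow hu.le huv hα.le
  have h1 : 1 - u ^ α / (u ^ α + v ^ α) = v ^ α / (u ^ α + v ^ α) := by field_simp; ring
  have h := splitDominance_le hα hμ (p := u ^ α / (u ^ α + v ^ α)) (by positivity)
    (by rw [div_le_div_iff₀ (by positivity) two_pos]; linarith)
  rw [splitDominance, h1, Real.div_rpow hu'.le (by positivity),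
    Real.div_rpow hv'.le (by positivity), ← Real.rpow_mul hu.le, ← Real.rpow_mul hv.le,
    mul_one_div_cancel hα.ne', Real.rpow_one, Real.rpow_one, div_eq_inv_mul u, div_eq_inv_mul v,
    dominance_mul_left μ (by positivity)] at h
  exact h

theorem IsStableDesign.exists_law {Ω : Type*} [MeasurableSpace Ω] {P : Measure Ω}
    [IsProbabilityMeasure P] {α : ℝ} {N M : ℕ} {S : Ω → Fin N → Fin M → ℝ}
    (hS : IsStableDesign P α S) (i : Fin N) (j : Fin M) :
    ∃ μ : Measure ℝ, IsProbabilityMeasure μ ∧ IsUnitStableLaw α μ ∧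
      ∀ k l, P.map (fun ω => S ω k l) = μ := by
  have hp : ∀ k l, IsProbabilityMeasure (P.map fun ω => S ω k l) := fun k l =>
    Measure.isProbabilityMeasure_map (hS.stable k l).1
  refine ⟨P.map fun ω => S ω i j, hp i j, (hS.stable i j).2, fun k l => ?_⟩
  have := hp k l
  have := hp i j
  exact Measure.ext_of_charFun (funext fun t => by rw [(hS.stable k l).2, (hS.stable i j).2])

/-- The columns of a stable design are i.i.d. with i.i.d. entries, so an event that constrains each
column separately has product probability. -/
theorem IsStableDesign.measureReal_forall_column {Ω : Type*} [MeasurableSpace Ω] {P : Measure Ω}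
    [IsProbabilityMeasure P] {α : ℝ} {N M : ℕ} {S : Ω → Fin N → Fin M → ℝ}
    (hS : IsStableDesign P α S) {μ : Measure ℝ} [IsProbabilityMeasure μ]
    (hμ : ∀ k l, P.map (fun ω => S ω k l) = μ) (T : Fin M → Set (Fin N → ℝ))
    (hT : ∀ j, MeasurableSet (T j)) :
    P.real {ω | ∀ j, (fun k => S ω k j) ∈ T j} =
      ∏ j, (Measure.pi fun _ : Fin N => μ).real (T j) := by
  have hae : ∀ p : Fin M × Fin N, AEMeasurable (fun ω => S ω p.2 p.1) P := fun p =>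
    (hS.stable p.2 p.1).1
  have hind : iIndepFun (fun (p : Fin M × Fin N) ω => S ω p.2 p.1) P :=
    hS.indep.precomp (g := Prod.swap) Prod.swap_injective
  have hlaw := (iIndepFun_iff_map_fun_eq_pi_map hae).1 hind
  simp only [hμ] at hlaw
  have hcurry := Measure.infinitePi_map_curry (fun (_ : Fin M) (_ : Fin N) => μ)
  simp only [Measure.infinitePi_eq_pi] at hcurry
  have hms : MeasurableSet (Set.univ.pi T) := MeasurableSet.univ_pi hT
  have h1 : {ω | ∀ j, (fun k => S ω k j) ∈ T j} =
      (fun ω (p : Fin M × Fin N) => S ω p.2 p.1) ⁻¹'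
        (MeasurableEquiv.curry (Fin M) (Fin N) ℝ ⁻¹' Set.univ.pi T) := by
    ext ω
    simp only [Set.mem_ofPred_eq, Set.mem_preimage, Set.mem_univ_pi]
    rfl
  rw [h1, ← map_measureReal_apply_of_aemeasurable (aemeasurable_pi_lambda _ hae)
    ((MeasurableEquiv.curry (Fin M) (Fin N) ℝ).measurable hms), hlaw,
    ← map_measureReal_apply (MeasurableEquiv.curry (Fin M) (Fin N) ℝ).measurable hms, hcurry,
    measureReal_def, Measure.pi_pi, ENNReal.toReal_prod]
  rfl

theorem theta_pos {N : ℕ} (α : ℝ) {x : Fin N → ℝ} (hx : x ≠ 0) : 0 < theta α x := by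
  obtain ⟨k, hk⟩ := Function.ne_iff.1 hx
  refine Real.rpow_pos_of_pos (Finset.sum_pos' (fun i _ => by positivity)
    ⟨k, Finset.mem_univ k, Real.rpow_pos_of_pos (abs_pos.2 hk) _⟩) _

/-- The tail bound for the ratio of two independent stable variables on the scale used by `psi`. -/
theorem dominance_le_one_div {α : ℝ} (hα : 0 < α) (hα1 : α ≠ 1) {μ : Measure ℝ}
    [IsProbabilityMeasure μ] (hμ : IsUnitStableLaw α μ) {u v : ℝ} (hu : 0 < u) (hv : 0 < v)
    (huv : (u / v) ^ (α / (1 - α)) < 1) :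
    dominance μ u v ≤ 1 / (1 + (u / v) ^ (α / (1 - α))) := by
  have hr : 0 < u / v := by positivity
  rcases lt_or_gt_of_ne hα1 with h | h
  · have hα' : 0 < 1 - α := by linarith
    have hr1 : u / v < 1 := by
      by_contra! h1
      exact absurd (Real.one_le_rpow h1 (by positivity : 0 ≤ α / (1 - α))) (not_le.2 huv)
    have hle : u ≤ v := by rw [div_lt_one hv] at hr1; exact hr1.le
    refine (dominance_le hα hμ hu hle).trans ?_
    -- For `α < 1` the exponent `α / (1 - α)` is at least `α`, and the base is below `1`.
    have h2 : (u / v) ^ (α / (1 - α)) ≤ (u / v) ^ α := by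
      refine Real.rpow_le_rpow_of_exponent_ge hr hr1.le ?_
      rw [le_div_iff₀ hα']
      nlinarith
    have h3 : v ^ α / (u ^ α + v ^ α) = 1 / (1 + (u / v) ^ α) := by
      rw [Real.div_rpow hu.le hv.le]
      have : 0 < v ^ α := by positivity
      field_simp
      ring
    rw [h3]
    gcongr
  -- For `α > 1` the exponent is negative, so `huv` forces `v ≤ u`; the bound `1/2` at equal scales
  -- is then enough.
  · have hvu : v ≤ u := by
      by_contra! h1
      exact absurd (Real.one_le_rpow_of_pos_of_le_one_of_nonpos hr ((div_lt_one hv).2 h1).le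
        (div_nonpos_of_nonneg_of_nonpos hα.le (by linarith))) (not_le.2 huv)
    calc dominance μ u v ≤ dominance μ v v := dominance_mono μ hvu le_rfl
      _ ≤ v ^ α / (v ^ α + v ^ α) := dominance_le hα hμ hv le_rfl
      _ = 1 / (1 + 1) := by
        have : 0 < v ^ α := by positivity
        field_simp
      _ ≤ 1 / (1 + (u / v) ^ (α / (1 - α))) := by gcongr

theorem mul_abs_lt_of_lt_abs_noisyRatio {N M : ℕ} {ρ : Fin M → ℝ} {x : Fin N → ℝ} {s : Fin N → Fin M → ℝ}
    {i : Fin N} {j : Fin M} {ε : ℝ} (hε : 0 < ε) (h : ε < |noisyRatio ρ x s i j|) :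
    ε * |s i j| < |ρ j * measurement x s j| := by
  rw [noisyRatio, abs_div] at h
  rcases eq_or_ne (s i j) 0 with h0 | h0
  -- Division by zero gives ratio `0`, which cannot exceed `ε`.
  · rw [h0, abs_zero, div_zero] at h
    linarith
  · rwa [lt_div_iff₀ (abs_pos.2 h0)] at h

end StableRecovery

theorem mainTheorem8 {Ω : Type*} [MeasurableSpace Ω] (P : Measure Ω) [IsProbabilityMeasure P]
    {N M : ℕ} (α : ℝ) (hα0 : 0 < α) (hα2 : α ≤ 2) (hα1 : α ≠ 1)
    (S : Ω → Fin N → Fin M → ℝ) (hS : StableRecovery.IsStableDesign P α S)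
    (x : Fin N → ℝ) (hx : x ≠ 0)
    (ρ : Fin M → ℝ) (hρ : ∀ j, 0 < ρ j)
    (ε : ℝ) (hε : 0 < ε)
    (hψ : ∀ j, StableRecovery.psi α ε x / ρ j ^ (α / (1 - α)) < 1 / 3)
    (i : Fin N)
    (t : Ω → Fin M)
    (ht : ∀ ω, StableRecovery.IsAbsArgmin (StableRecovery.noisyRatio ρ x (S ω) i) (t ω)) :
    P.real {ω | ε < |StableRecovery.noisyRatio ρ x (S ω) i (t ω)| ∧ x i = 0} ≤
      ∏ j, 1 / (1 + StableRecovery.psi α ε x / ρ j ^ (α / (1 - α))) := by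
  open StableRecovery in
  have hθ := theta_pos α hx
  have hpsi : ∀ j, psi α ε x / ρ j ^ (α / (1 - α)) =
      (ε / (ρ j * theta α x)) ^ (α / (1 - α)) := fun j => by
    rw [psi, ← Real.div_rpow (by positivity) (hρ j).le, div_div, mul_comm (ρ j)]
  by_cases hxi : x i = 0
  swap
  · simp only [hxi, and_false]
    rw [show {_ω : Ω | False} = ∅ from rfl, measureReal_empty]
    refine Finset.prod_nonneg fun j _ => ?_
    rw [hpsi]
    have := hρ j
    positivity
  -- A sample point yields the column `t ω₀`, so an entry exists from which to read off the common
  -- law.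
  obtain ⟨ω₀⟩ := P.nonempty_of_neZero
  obtain ⟨μ, hμp, hμs, hμ⟩ := hS.exists_law i (t ω₀)
  -- `Pi.single i ε` writes `ε s_ij` as a linear form; its support is disjoint from that of `x`
  -- because `x i = 0`.
  set T : Fin M → Set (Fin N → ℝ) := fun j =>
    {v | |∑ k, Pi.single (M := fun _ => ℝ) i ε k * v k| < |∑ k, (ρ j * x k) * v k|} with hT
  have hTm : ∀ j, MeasurableSet (T j) := fun j =>
    measurableSet_lt (measurable_linearForm _).abs (measurable_linearForm _).abs
  calc P.real {ω | ε < |noisyRatio ρ x (S ω) i (t ω)| ∧ x i = 0}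
      ≤ P.real {ω | ∀ j, (fun k => S ω k j) ∈ T j} := by
        refine measureReal_mono fun ω hω j => ?_
        have h := mul_abs_lt_of_lt_abs_noisyRatio hε (hω.1.trans_le (ht ω j))
        simp only [hT, Set.mem_ofPred_eq, mul_assoc, ← Finset.mul_sum, Pi.single_apply, ite_mul,
          zero_mul, Finset.sum_ite_eq', Finset.mem_univ, if_true]
        rw [abs_mul, abs_of_pos hε]
        exact h
    _ = ∏ j, (Measure.pi fun _ : Fin N => μ).real (T j) :=
        hS.measureReal_forall_column hμ T hTm
    _ ≤ ∏ j, 1 / (1 + psi α ε x / ρ j ^ (α / (1 - α))) := by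
        refine Finset.prod_le_prod (fun j _ => measureReal_nonneg) fun j _ => ?_
        have hb : (∑ k, |Pi.single (M := fun _ => ℝ) i ε k| ^ α) ^ (1 / α) = ε := by
          rw [Finset.sum_eq_single i (fun k _ hk => by simp [hk, Real.zero_rpow hα0.ne'])
            (by simp), Pi.single_eq_same, abs_of_pos hε, ← Real.rpow_mul hε.le,
            mul_one_div_cancel hα0.ne', Real.rpow_one]
        have ha : (∑ k, |ρ j * x k| ^ α) ^ (1 / α) = ρ j * theta α x := by
          have hρj := hρ j
          simp only [abs_mul, Real.mul_rpow (abs_nonneg (ρ j)) (abs_nonneg _), ← Finset.mul_sum]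
          rw [abs_of_pos hρj, Real.mul_rpow (by positivity) (Finset.sum_nonneg fun k _ => by positivity),
            ← Real.rpow_mul hρj.le, mul_one_div_cancel hα0.ne', Real.rpow_one, theta]
        have hdisj : ∀ k, ρ j * x k = 0 ∨ Pi.single (M := fun _ => ℝ) i ε k = 0 := fun k => by
          rcases eq_or_ne k i with rfl | hk
          · simp [hxi]
          · simp [hk]
        rw [hT, measureReal_linearForm_lt hα0 hμs _ _ hdisj, ha, hb, hpsi]
        refine dominance_le_one_div hα0 hα1 hμs hε (mul_pos (hρ j) hθ) ?_
        rw [← hpsi]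
        linarith [hψ j]
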